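/- A weighted graph $\Gamma$ is an undirected graph without loops or multiple edges in which each edge $xy$ carries a weight $\omega_{xy}=\omega_{yx}>0$. If $\Gamma$ is locally finite (each vertex has finitely many neighbours), put $\deg x=\sum_{y\sim x}\omega_{xy}$; a function $f:\Gamma\to\mathbb R$ on the vertices is harmonic if $$f(x)-\frac{1}{\deg x}\sum_{y\sim x}\omega_{xy}f(y)=0\qquad\text{for every vertex }x.$$ $\Gamma$ is vertex-transitive if for all vertices $x,y$ there is an automorphism of the graph that preserves the weights and maps $x$ to $y$. Proposition. Let $\Gamma$ be an infinite, locally finite, vertex-transitive weighted graph (not necessarily connected) with at least one edge. Then there is a non-constant harmonic function $f:\Gamma\to\mathbb R$. -/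

import Mathlib

/-- A weighted graph on the vertex type `V`: an undirected graph without loops or multiple edges,
each edge `xy` of which carries a weight `ω x y = ω y x > 0`. Weights of non-edges are zero by
convention, so that a weighted graph is determined by its edges and their weights. -/
structure WeightedGraph (V : Type*) where
  /-- the underlying simple graph -/
  graph : SimpleGraph V
  /-- the weight function -/
  weight : V → V → ℝ
  weight_symm : ∀ x y, weight x y = weight y x
  weight_pos : ∀ x y, graph.Adj x y → 0 < weight x y
  weight_eq_zero : ∀ x y, ¬ graph.Adj x y → weight x y = 0

namespace WeightedGraph

variable {V : Type*} (Γ : WeightedGraph V)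

/-- An automorphism of the underlying graph is an automorphism of the weighted graph if it
preserves the weights. -/
def IsAut (φ : Γ.graph ≃g Γ.graph) : Prop :=
  ∀ x y, Γ.weight (φ x) (φ y) = Γ.weight x y

/-- The weighted automorphisms act transitively on the vertices. -/
def IsVertexTransitive : Prop :=
  ∀ x y, ∃ φ : Γ.graph ≃g Γ.graph, Γ.IsAut φ ∧ φ x = y

/-- The degree `deg x = ∑_{y ∼ x} ω x y`. -/
noncomputable def deg [Γ.graph.LocallyFinite] (x : V) : ℝ :=
  ∑ y ∈ Γ.graph.neighborFinset x, Γ.weight x y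

/-- The Laplacian `Δ f (x) = f x - (1 / deg x) ∑_{y ∼ x} ω x y f y`. The formula is meaningful at
the vertices of nonzero degree, that is, those that have a neighbour. -/
noncomputable def laplacian [Γ.graph.LocallyFinite] (f : V → ℝ) (x : V) : ℝ :=
  f x - 1 / Γ.deg x * ∑ y ∈ Γ.graph.neighborFinset x, Γ.weight x y * f y

/-- A function is harmonic if it is in the kernel of the Laplacian. -/
def IsHarmonic [Γ.graph.LocallyFinite] (f : V → ℝ) : Prop :=
  Γ.laplacian f = 0

end WeightedGraph

namespace WeightedGraph

variable {V : Type*} (Γ : WeightedGraph V)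

/-! If the graph is disconnected, the indicator of a component is harmonic. Otherwise suppose that
all harmonic functions are constant. By duality with finitely supported functions, the Laplacian is
surjective (`exists_lap_eq`), so some `f` has Laplacian `δ_o`. Again by duality, for each neighbour
`y` of `o` the difference of values at `o` and `y` is a fixed finite combination of values of the
Laplacian (`exists_lapFinsupp_eq_sub`). Automorphisms carry these formulas to every edge; far from
`o` they only see zeros, so `f` is locally constant off a finite ball. Then `f` has finitely many
values, and the maximum principle makes it constant, contradicting `δ_o ≠ 0`. -/

/-- The unnormalised Laplacian `∑_{y ∼ x} ω x y (f x - f y)`. -/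
noncomputable def lap [Γ.graph.LocallyFinite] (f : V → ℝ) (x : V) : ℝ :=
  ∑ y ∈ Γ.graph.neighborFinset x, Γ.weight x y * (f x - f y)

theorem deg_pos {Γ : WeightedGraph V} [Γ.graph.LocallyFinite] {x y : V} (h : Γ.graph.Adj x y) : 0 < Γ.deg x :=
  Finset.sum_pos (fun z hz => Γ.weight_pos x z (by simpa using hz)) ⟨y, by simpa using h⟩

theorem lap_eq_deg_mul_laplacian [Γ.graph.LocallyFinite] (f : V → ℝ) {x : V}
    (hx : Γ.deg x ≠ 0) : Γ.lap f x = Γ.deg x * Γ.laplacian f x := by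
  have h : Γ.lap f x = Γ.deg x * f x - ∑ y ∈ Γ.graph.neighborFinset x, Γ.weight x y * f y := by
    simp only [lap, deg, mul_sub, Finset.sum_sub_distrib, Finset.sum_mul]
  rw [h, laplacian]
  field_simp

theorem isHarmonic_of_lap_eq_zero [Γ.graph.LocallyFinite] (hdeg : ∀ x, Γ.deg x ≠ 0)
    {f : V → ℝ} (h : ∀ x, Γ.lap f x = 0) : Γ.IsHarmonic f := by
  funext x
  have := h x
  rw [Γ.lap_eq_deg_mul_laplacian f (hdeg x)] at this
  exact (mul_eq_zero.mp this).resolve_left (hdeg x)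

theorem lap_comp [Γ.graph.LocallyFinite] {φ : Γ.graph ≃g Γ.graph} (hφ : Γ.IsAut φ)
    (f : V → ℝ) (x : V) : Γ.lap (f ∘ φ) x = Γ.lap f (φ x) := by
  refine Finset.sum_bij (fun y _ => φ y) ?_ ?_ ?_ ?_
  · intro y hy
    have : Γ.graph.Adj x y := by simpa using hy
    simpa using φ.map_rel_iff.mpr this
  · intro a _ b _ h
    exact φ.injective h
  · intro y hy
    refine ⟨φ.symm y, ?_, by simp⟩
    have : Γ.graph.Adj (φ x) (φ (φ.symm y)) := by simpa using hy
    simpa using φ.map_rel_iff.mp this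
  · intro y _
    simp [hφ x y]

/-- The transpose of the Laplacian, acting on finitely supported functions. -/
noncomputable def lapFinsupp [Γ.graph.LocallyFinite] : (V →₀ ℝ) →ₗ[ℝ] (V →₀ ℝ) :=
  Finsupp.linearCombination ℝ fun x => ∑ y ∈ Γ.graph.neighborFinset x,
    Γ.weight x y • (Finsupp.single x (1 : ℝ) - Finsupp.single y 1)

theorem linearCombination_lapFinsupp [Γ.graph.LocallyFinite] (f : V → ℝ) (g : V →₀ ℝ) :
    Finsupp.linearCombination ℝ f (Γ.lapFinsupp g) =
      Finsupp.linearCombination ℝ (Γ.lap f) g := by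
  induction g using Finsupp.induction_linear with
  | zero => simp
  | add g h hg hh => simp only [map_add, hg, hh]
  | single x r => simp [lapFinsupp, lap]

/-- Symmetry of the weights makes the Laplacian its own transpose, which opens the kernel of
`lapFinsupp` to the maximum principle. -/
theorem lapFinsupp_apply [Γ.graph.LocallyFinite] (g : V →₀ ℝ) (z : V) :
    Γ.lapFinsupp g z = Γ.lap g z := by
  classical
  induction g using Finsupp.induction_linear with
  | zero => simp [lap]
  | add g h hg hh =>
    rw [map_add, Finsupp.add_apply, hg, hh]
    simp only [lap, Finsupp.add_apply, ← Finset.sum_add_distrib]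
    exact Finset.sum_congr rfl fun _ _ => by ring
  | single x r =>
    by_cases h : x = z
    · subst h
      simp only [lapFinsupp, lap, Finsupp.linearCombination_single, Finsupp.smul_apply,
        Finsupp.finsetSum_apply, Finsupp.sub_apply, Finset.smul_sum, smul_eq_mul]
      refine Finset.sum_congr rfl fun y hy => ?_
      have hxy : y ≠ x := by
        have : Γ.graph.Adj x y := by simpa using hy
        exact this.ne'
      simp [Finsupp.single_eq_of_ne hxy, Finsupp.single_eq_of_ne hxy.symm, mul_comm]
    · simp only [lapFinsupp, lap, Finsupp.linearCombination_single, Finsupp.smul_apply,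
        Finsupp.finsetSum_apply, Finsupp.sub_apply, smul_eq_mul,
        Finsupp.single_apply, h, if_false, zero_sub, mul_neg, mul_ite, mul_one, mul_zero,
        Finset.sum_neg_distrib, Finset.sum_ite_eq', Finset.sum_ite_eq,
        SimpleGraph.mem_neighborFinset, Γ.graph.adj_comm z x, Γ.weight_symm z x]
      split_ifs <;> ring

variable {Γ}

/-- The maximum principle, spreading from a maximum along edges up to the exceptional vertex. -/
theorem eq_of_isMax [Γ.graph.LocallyFinite] {f : V → ℝ} {o z : V}
    (hlap : ∀ x, x ≠ o → Γ.lap f x = 0) (p : Γ.graph.Walk z o) (hmax : ∀ x, f x ≤ f z) :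
    f z = f o := by
  induction p with
  | nil => rfl
  | @cons u v w h p ih =>
    by_cases huo : u = w
    · rw [huo]
    · have hnonneg : ∀ y ∈ Γ.graph.neighborFinset u, 0 ≤ Γ.weight u y * (f u - f y) :=
        fun y hy => mul_nonneg (Γ.weight_pos u y (by simpa using hy)).le
          (sub_nonneg.mpr (hmax y))
      have hv := (Finset.sum_eq_zero_iff_of_nonneg hnonneg).mp (hlap u huo) v (by simpa using h)
      have huv : f u = f v :=
        sub_eq_zero.mp ((mul_eq_zero.mp hv).resolve_left (Γ.weight_pos u v h).ne')
      rw [huv]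
      exact ih hlap fun x => huv ▸ hmax x

theorem lap_neg [Γ.graph.LocallyFinite] (f : V → ℝ) (x : V) :
    Γ.lap (fun y => -f y) x = -Γ.lap f x := by
  simp only [lap, ← Finset.sum_neg_distrib]
  exact Finset.sum_congr rfl fun _ _ => by ring

theorem le_of_finite_range [Γ.graph.LocallyFinite] (hconn : Γ.graph.Preconnected) {f : V → ℝ}
    {o : V} (hlap : ∀ x, x ≠ o → Γ.lap f x = 0) (hfin : (Set.range f).Finite) (x : V) :
    f x ≤ f o := by
  obtain ⟨_, ⟨z, rfl⟩, hz⟩ := hfin.exists_maximal ⟨f o, o, rfl⟩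
  have hmax : ∀ y, f y ≤ f z := fun y =>
    (le_total (f y) (f z)).elim id fun h => hz ⟨y, rfl⟩ h
  obtain ⟨p⟩ := hconn z o
  exact eq_of_isMax hlap p hmax ▸ hmax x

/-- A function with finitely many values that is harmonic off one vertex is constant. -/
theorem eq_of_finite_range [Γ.graph.LocallyFinite] (hconn : Γ.graph.Preconnected) {f : V → ℝ}
    {o : V} (hlap : ∀ x, x ≠ o → Γ.lap f x = 0) (hfin : (Set.range f).Finite) (x : V) :
    f x = f o := by
  refine le_antisymm (le_of_finite_range hconn hlap hfin x) ?_
  have hfin' : (Set.range fun y => -f y).Finite :=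
    (hfin.image Neg.neg).subset (by rintro _ ⟨y, rfl⟩; exact ⟨f y, ⟨y, rfl⟩, rfl⟩)
  have := le_of_finite_range hconn (f := fun y => -f y) (o := o)
    (fun y hy => by rw [lap_neg, hlap y hy, neg_zero]) hfin' x
  linarith

theorem lapFinsupp_injective [Infinite V] [Γ.graph.LocallyFinite]
    (hconn : Γ.graph.Preconnected) : Function.Injective Γ.lapFinsupp := by
  rw [← LinearMap.ker_eq_bot, LinearMap.ker_eq_bot']
  intro g hg
  -- As `V` is infinite, `g` vanishes somewhere; being constant, it is zero.
  obtain ⟨o, ho⟩ := Infinite.exists_notMem_finset g.support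
  have hfin : (Set.range g).Finite := g.finite_range
  ext x
  rw [eq_of_finite_range hconn (o := o) (fun x _ => by rw [← lapFinsupp_apply, hg]; rfl) hfin x]
  simpa using ho

/-! ### Duality between `V →₀ ℝ` and `V → ℝ` -/

theorem linearCombination_apply_single (F : Module.Dual ℝ (V →₀ ℝ)) :
    Finsupp.linearCombination ℝ (fun x => F (Finsupp.single x 1)) = F := by
  ext x
  simp

/-- The Laplacian of an infinite connected graph is surjective. -/
theorem exists_lap_eq [Infinite V] [Γ.graph.LocallyFinite] (hconn : Γ.graph.Preconnected)
    (h : V → ℝ) : ∃ f : V → ℝ, ∀ x, Γ.lap f x = h x := by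
  obtain ⟨F, hF⟩ := LinearMap.dualMap_surjective_of_injective (lapFinsupp_injective hconn)
    (Finsupp.linearCombination ℝ h)
  refine ⟨fun x => F (Finsupp.single x 1), fun x => ?_⟩
  have h1 := Γ.linearCombination_lapFinsupp (fun x => F (Finsupp.single x 1))
    (Finsupp.single x 1)
  have h2 := LinearMap.congr_fun hF (Finsupp.single x 1)
  rw [linearCombination_apply_single] at h1
  simp only [LinearMap.dualMap_apply, Finsupp.linearCombination_single, one_smul] at h1 h2
  rw [← h1, h2]

/-- If all harmonic functions agree at `x` and `y`, then this is witnessed by a finite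
combination of values of the Laplacian. -/
theorem exists_lapFinsupp_eq_sub [Γ.graph.LocallyFinite] {x y : V}
    (hxy : ∀ f : V → ℝ, (∀ z, Γ.lap f z = 0) → f x = f y) :
    ∃ g, Γ.lapFinsupp g = Finsupp.single x 1 - Finsupp.single y 1 := by
  -- Functionals that vanish on the range of `lapFinsupp` are exactly the harmonic functions.
  refine (Subspace.forall_mem_dualAnnihilator_apply_eq_zero_iff
    (LinearMap.range Γ.lapFinsupp) _).mp fun F hF => ?_
  rw [Submodule.mem_dualAnnihilator] at hF
  rw [map_sub, sub_eq_zero]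
  refine hxy (fun x => F (Finsupp.single x 1)) fun z => ?_
  have h1 := Γ.linearCombination_lapFinsupp (fun x => F (Finsupp.single x 1))
    (Finsupp.single z 1)
  rw [linearCombination_apply_single, hF _ ⟨_, rfl⟩] at h1
  simpa using h1.symm

/-! ### Balls and local constancy -/

theorem finite_setOf_walk_length_le [Γ.graph.LocallyFinite] (n : ℕ) :
    ∀ o, {z | ∃ p : Γ.graph.Walk o z, p.length ≤ n}.Finite := by
  induction n with
  | zero =>
    intro o
    refine (Set.finite_singleton o).subset ?_
    rintro z ⟨p, hp⟩
    exact (SimpleGraph.Walk.eq_of_length_eq_zero (Nat.le_zero.mp hp)).symm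
  | succ n ih =>
    intro o
    refine ((Set.finite_singleton o).union
      ((Γ.graph.neighborFinset o).finite_toSet.biUnion fun v _ => ih v)).subset ?_
    rintro z ⟨p, hp⟩
    cases p with
    | nil => exact Or.inl rfl
    | @cons _ v _ h p =>
      refine Or.inr (Set.mem_biUnion (x := v) (by simpa using h) ⟨p, ?_⟩)
      simpa using hp

theorem finite_setOf_dist_le [Γ.graph.LocallyFinite] (hconn : Γ.graph.Preconnected)
    (o : V) (n : ℕ) : {z | Γ.graph.dist o z ≤ n}.Finite := by
  refine (finite_setOf_walk_length_le (Γ := Γ) n o).subset fun z hz => ?_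
  obtain ⟨p, hp⟩ := (hconn o z).exists_walk_length_eq_dist
  exact ⟨p, hp.trans_le hz⟩

theorem dist_map_le (hconn : Γ.graph.Preconnected) (φ : Γ.graph ≃g Γ.graph) (x y : V) :
    Γ.graph.dist (φ x) (φ y) ≤ Γ.graph.dist x y := by
  obtain ⟨p, hp⟩ := (hconn x y).exists_walk_length_eq_dist
  rw [← hp, ← SimpleGraph.Walk.length_map φ.toHom p]
  exact SimpleGraph.dist_le _

/-- A function that is locally constant off a finite set of vertices takes finitely many values. -/
theorem finite_range_of_locally_constant (hconn : Γ.graph.Preconnected) {f : V → ℝ} {S : Set V}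
    (hS : S.Finite) (h : ∀ x ∉ S, ∀ y, Γ.graph.Adj x y → f x = f y) (o : V) :
    (Set.range f).Finite := by
  refine ((hS.insert o).image f).subset ?_
  rintro _ ⟨x, rfl⟩
  obtain ⟨p⟩ := hconn x o
  -- Along a walk to `o`, the value of `f` persists until the walk meets `S` or ends.
  induction p with
  | nil => exact ⟨_, Or.inl rfl, rfl⟩
  | @cons u v w huv p ih =>
    by_cases hu : u ∈ S
    · exact ⟨u, Or.inr hu, rfl⟩
    · rw [h u hu v huv]
      exact ih

/-- If a vertex-transitive connected graph has only constant harmonic functions, then a function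
that is harmonic off one vertex is locally constant off a finite set. -/
theorem exists_finite_locally_constant [Γ.graph.LocallyFinite] (hconn : Γ.graph.Preconnected)
    (hΓ : Γ.IsVertexTransitive)
    (hconst : ∀ f : V → ℝ, (∀ z, Γ.lap f z = 0) → ∀ x y, f x = f y) {f : V → ℝ} {o : V}
    (hlap : ∀ x, x ≠ o → Γ.lap f x = 0) :
    ∃ S : Set V, S.Finite ∧ ∀ x ∉ S, ∀ y, Γ.graph.Adj x y → f x = f y := by
  classical
  choose g hg using fun y => exists_lapFinsupp_eq_sub (x := o) (y := y)
    fun f hf => hconst f hf o y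
  let T := (Γ.graph.neighborFinset o).biUnion fun y => (g y).support
  -- The ball of radius `D` about `o` contains the supports of `g y` for all neighbours `y` of `o`.
  let D := T.sup (Γ.graph.dist o)
  refine ⟨{z | Γ.graph.dist o z ≤ D}, finite_setOf_dist_le hconn o D, fun x hx y hxy => ?_⟩
  obtain ⟨φ, hφ, rfl⟩ := hΓ o x
  obtain ⟨y, rfl⟩ := φ.surjective y
  have hoy : Γ.graph.Adj o y := φ.map_rel_iff.mp hxy
  have key := Γ.linearCombination_lapFinsupp (f ∘ φ) (g y)
  rw [hg] at key
  have hzero : Finsupp.linearCombination ℝ (Γ.lap (f ∘ φ)) (g y) = 0 := by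
    rw [Finsupp.linearCombination_apply]
    refine Finset.sum_eq_zero fun u hu => ?_
    have huT : u ∈ T := Finset.mem_biUnion.mpr ⟨y, by simpa using hoy, hu⟩
    have huo : φ u ≠ o := by
      intro h
      apply hx
      calc Γ.graph.dist o (φ o) = Γ.graph.dist (φ o) (φ u) := by rw [h, SimpleGraph.dist_comm]
        _ ≤ Γ.graph.dist o u := dist_map_le hconn φ o u
        _ ≤ D := Finset.le_sup (f := Γ.graph.dist o) huT
    simp only [Γ.lap_comp hφ, hlap _ huo, smul_zero]
  rw [hzero] at key
  simpa [sub_eq_zero] using key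

theorem exists_nonconstant_of_preconnected [Infinite V] [Γ.graph.LocallyFinite]
    (hΓ : Γ.IsVertexTransitive) (hconn : Γ.graph.Preconnected) :
    ∃ f : V → ℝ, (∀ x, Γ.lap f x = 0) ∧ ∃ x y, f x ≠ f y := by
  classical
  by_contra! hconst
  obtain ⟨o⟩ : Nonempty V := inferInstance
  obtain ⟨f, hf⟩ := exists_lap_eq hconn (Pi.single o (1 : ℝ))
  have hlap : ∀ x, x ≠ o → Γ.lap f x = 0 := fun x hx => by rw [hf, Pi.single_eq_of_ne hx]
  obtain ⟨S, hS, hloc⟩ := exists_finite_locally_constant hconn hΓ hconst hlap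
  have heq := eq_of_finite_range hconn hlap (finite_range_of_locally_constant hconn hS hloc o)
  have h0 : Γ.lap f o = 0 := Finset.sum_eq_zero fun y _ => by rw [heq y, sub_self, mul_zero]
  rw [hf, Pi.single_eq_same] at h0
  exact one_ne_zero h0

theorem exists_nonconstant_of_not_preconnected [Γ.graph.LocallyFinite]
    (hconn : ¬ Γ.graph.Preconnected) :
    ∃ f : V → ℝ, (∀ x, Γ.lap f x = 0) ∧ ∃ x y, f x ≠ f y := by
  classical
  simp only [SimpleGraph.Preconnected, not_forall] at hconn
  obtain ⟨x, y, hxy⟩ := hconn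
  refine ⟨fun z => if Γ.graph.Reachable x z then 1 else 0, fun z => ?_, x, y, ?_⟩
  · refine Finset.sum_eq_zero fun w hw => ?_
    have hzw : Γ.graph.Adj z w := by simpa using hw
    have : Γ.graph.Reachable x z ↔ Γ.graph.Reachable x w :=
      ⟨fun h => h.trans hzw.reachable, fun h => h.trans hzw.symm.reachable⟩
    simp [this]
  · simp [hxy]

theorem IsVertexTransitive.deg_ne_zero [Γ.graph.LocallyFinite] (hΓ : Γ.IsVertexTransitive)
    (hedge : ∃ x y, Γ.graph.Adj x y) (z : V) : Γ.deg z ≠ 0 := by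
  obtain ⟨x, y, hxy⟩ := hedge
  obtain ⟨φ, -, rfl⟩ := hΓ x z
  exact (deg_pos (φ.map_rel_iff.mpr hxy)).ne'

end WeightedGraph

theorem proposition1p3 {V : Type*} [Infinite V] (Γ : WeightedGraph V) [Γ.graph.LocallyFinite]
    (hΓ : Γ.IsVertexTransitive) (hedge : ∃ x y, Γ.graph.Adj x y) :
    ∃ f : V → ℝ, Γ.IsHarmonic f ∧ ∃ x y, f x ≠ f y := by
  obtain ⟨f, hf, hne⟩ : ∃ f : V → ℝ, (∀ x, Γ.lap f x = 0) ∧ ∃ x y, f x ≠ f y := by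
    by_cases hconn : Γ.graph.Preconnected
    · exact WeightedGraph.exists_nonconstant_of_preconnected hΓ hconn
    · exact WeightedGraph.exists_nonconstant_of_not_preconnected hconn
  exact ⟨f, Γ.isHarmonic_of_lap_eq_zero (hΓ.deg_ne_zero hedge) hf, hne⟩
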